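/- Throughout, $\mathrm{C}^*$-algebras may be non-unital, *-homomorphisms and left actions may be degenerate, and $X\cdot Y$ denotes the closed linear span of the products $xy$ with $x\in X$, $y\in Y$. Let $A$ be a $\mathrm{C}^*$-algebra. A \emph{weak partial product system} over $\mathbb N$ consists of $A,A$-correspondences $\mathcal E_n$ for $n\in\mathbb N$ (right Hilbert $A$-modules with a left action of $A$ by adjointable operators) with $\mathcal E_0=A$ the identity correspondence, and isometric bimodule maps $\mu_{n,m}\colon \mathcal E_n\otimes_A\mathcal E_m\to\mathcal E_{n+m}$, written $x\otimes y\mapsto x\cdot y$, that are associative, such that $\mu_{0,n}$ and $\mu_{n,0}$ are the canonical maps $a\otimes x\mapsto ax$ and $x\otimes a\mapsto xa$. A \emph{representation} of it in a $\mathrm{C}^*$-algebra $D$ is a family of linear maps $\omega_n\colon\mathcal E_n\to D$, $n\in\mathbb N$, with 1. $\omega_n(x)\omega_m(y)=\omega_{n+m}(x\cdot y)$ for all $n,m\in\mathbb N$, $x\in\mathcal E_n$, $y\in\mathcal E_m$; 2. $\omega_n(x)^*\omega_n(y)=\omega_0(\langle x,y\rangle)$ for all $n\in\mathbb N$, $x,y\in\mathcal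 E_n$; 3. $\omega_n(\mathcal E_n)^*\cdot\omega_m(\mathcal E_m)\subseteq\omega_{m-n}(\mathcal E_{m-n})\cdot D$ for all $m>n>0$; 4. $\omega_n(\mathcal E_n)^*\cdot\omega_m(\mathcal E_m)\subseteq\omega_{n-m}(\mathcal E_{n-m})^*\cdot D$ for all $n>m>0$. A weak partial product system is a \emph{partial product system} if its Fock representation exists and is a representation; that is, for all $n,m\in\mathbb N$ and $x\in\mathcal E_n$ the map $\mathcal E_m\to\mathcal E_{n+m}$, $y\mapsto x\cdot y$, is adjointable, and the resulting creation operators $S_n(x)$ on the Hilbert $A$-module $\bigoplus_{l\in\mathbb N}\mathcal E_l$, $S_n(x)z=x\cdot z$, satisfy $S_n(x)^*S_m(y)=S_{m-n}(S_n(x)^*y)$ for all $m>n>0$, $x\in\mathcal E_n$, $y\in\mathcal E_m$. A \emph{Toeplitz algebra} of a partial product system is a $\mathrm{C}^*$-algebra $\mathcal T$ with a representation $(\bar\omega_n)_{n\in\mathbb N}$ in $\mathcal T$ such that for every representation $(\omega_n)_{n\in\mathbb N}$ in a $\mathrm{C}^*$-algebra $D$ there is a unique *-homomorphism $\varrho\colon\mathcal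 T\to D$ with $\varrho\circ\bar\omega_n=\omega_n$ for all $n\in\mathbb N$. By the universal property, $\mathcal T$ carries a unique continuous action $\alpha$ of the circle group $\mathbb T$ by *-automorphisms, the \emph{gauge action}, with $\alpha_t(\bar\omega_n(x))=t^n\bar\omega_n(x)$ for all $t\in\mathbb T$, $n\in\mathbb N$, $x\in\mathcal E_n$. Let $\mathcal T_0=\{x\in\mathcal T : \alpha_t(x)=x\text{ for all }t\in\mathbb T\}$ be its fixed-point algebra. **Theorem.** Let $\mathcal T$ be a Toeplitz algebra of a partial product system. Let $B$ be a $\mathrm{C}^*$-algebra with a continuous action $\beta$ of $\mathbb T$ by *-automorphisms (continuous in the sense that $t\mapsto\beta_t(b)$ is norm continuous for each $b\in B$), and let $\varrho\colon\mathcal T\to B$ be a $\mathbb T$-equivariant *-homomorphism, that is, $\varrho(\alpha_t(x))=\beta_t(\varrho(x))$ for all $t\in\mathbb T$, $x\in\mathcal T$. If $\varrho$ is injective on $\mathcal T_0$, then $\varrho$ is injective on $\mathcal T$. -/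

import Mathlib

universe u v

/-! ### Right Hilbert modules and C*-correspondences

Mathlib's `CStarModule` is a left module with an inner product whose second variable is linear
for the left action.  Right Hilbert modules are therefore introduced here. -/

/-- A right Hilbert module over the (possibly non-unital) C*-algebra `A`: a complex Banach space
with a right action of `A` and an `A`-valued inner product, linear in the second variable, such
that `‖x‖ ^ 2 = ‖⟪x, x⟫‖`. -/
class RightHilbertModule (A : Type u) (E : Type v) [NonUnitalCStarAlgebra A]
    [NormedAddCommGroup E] [NormedSpace ℂ E] where
  /-- The inner product `⟪x, y⟫`. -/
  ip : E → E → A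
  /-- The right action: `ract x a` is `x · a`. -/
  ract : E → A → E
  complete : CompleteSpace E
  ract_add : ∀ x a b, ract x (a + b) = ract x a + ract x b
  add_ract : ∀ x y a, ract (x + y) a = ract x a + ract y a
  ract_mul : ∀ x a b, ract x (a * b) = ract (ract x a) b
  ract_smul : ∀ (c : ℂ) x a, ract x (c • a) = c • ract x a
  smul_ract : ∀ (c : ℂ) x a, ract (c • x) a = c • ract x a
  ip_add : ∀ x y z, ip x (y + z) = ip x y + ip x z
  ip_smul : ∀ (c : ℂ) x y, ip x (c • y) = c • ip x y
  ip_ract : ∀ x y a, ip x (ract y a) = ip x y * a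
  star_ip : ∀ x y, star (ip x y) = ip y x
  ip_self_nonneg : ∀ x, ∃ a, ip x x = star a * a
  norm_sq : ∀ x, ‖x‖ ^ 2 = ‖ip x x‖

/-- An `A,A`-correspondence: a right Hilbert `A`-module with a left action of `A` by adjointable
operators, that is, a *-homomorphism from `A` to the adjointable operators.  The left action need
not be nondegenerate. -/
class Correspondence (A : Type u) (E : Type v) [NonUnitalCStarAlgebra A]
    [NormedAddCommGroup E] [NormedSpace ℂ E] extends RightHilbertModule A E where
  /-- The left action: `lact a x` is `a · x`. -/
  lact : A → E → E
  add_lact : ∀ a b x, lact (a + b) x = lact a x + lact b x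
  lact_add : ∀ a x y, lact a (x + y) = lact a x + lact a y
  mul_lact : ∀ a b x, lact (a * b) x = lact a (lact b x)
  smul_lact : ∀ (c : ℂ) a x, lact (c • a) x = c • lact a x
  lact_smul : ∀ (c : ℂ) a x, lact a (c • x) = c • lact a x
  lact_ract : ∀ a x b, lact a (ract x b) = ract (lact a x) b
  ip_lact : ∀ a x y, ip (lact a x) y = ip x (lact (star a) y)

open RightHilbertModule Correspondence

/-! ### Weak partial product systems -/

/-- A weak partial product system over `ℕ` with coefficients `A` and fibres `H n`.

An isometric bimodule map `H n ⊗_A H m → H (n + m)` on the interior tensor product is given by the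
bilinear map `(x, y) ↦ x · y`, which has to satisfy
`⟪x · y, x' · y'⟫ = ⟪y, ⟪x, x'⟫ y'⟫` (this is `ip_mul`; it also makes the map balanced over `A`)
and to be compatible with the left and right actions of `A`.  To avoid casts between the fibres
`H ((n + m) + l)` and `H (n + (m + l))`, the multiplication takes a proof of `n + m = p` and has
values in `H p`.

The fibre `H 0` is identified by `unit` with the identity correspondence `A`, and the products with
`H 0` are the canonical ones. -/
structure WeakPartialProductSystem (A : Type u) [NonUnitalCStarAlgebra A] (H : ℕ → Type u)
    [∀ n, NormedAddCommGroup (H n)] [∀ n, NormedSpace ℂ (H n)]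
    [∀ n, Correspondence A (H n)] where
  /-- The multiplication `(x, y) ↦ x · y` from `H n × H m` to `H (n + m)`. -/
  mul : ∀ {n m p : ℕ}, n + m = p → H n →ₗ[ℂ] H m →ₗ[ℂ] H p
  ip_mul : ∀ {n m p : ℕ} (h : n + m = p) (x x' : H n) (y y' : H m),
    (ip (mul h x y) (mul h x' y') : A) = ip y (lact (ip x x' : A) y')
  lact_mul : ∀ {n m p : ℕ} (h : n + m = p) (a : A) (x : H n) (y : H m),
    lact a (mul h x y) = mul h (lact a x) y
  ract_mul : ∀ {n m p : ℕ} (h : n + m = p) (a : A) (x : H n) (y : H m),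
    ract (mul h x y) a = mul h x (ract y a)
  assoc : ∀ {n m l nm ml p : ℕ} (h₁ : n + m = nm) (h₂ : nm + l = p) (h₃ : m + l = ml)
    (h₄ : n + ml = p) (x : H n) (y : H m) (z : H l),
    mul h₂ (mul h₁ x y) z = mul h₄ x (mul h₃ y z)
  /-- The isomorphism between the identity correspondence `A` and `H 0`. -/
  unit : A ≃ₗ[ℂ] H 0
  ip_unit : ∀ a b : A, ip (unit a) (unit b) = star a * b
  lact_unit : ∀ a b : A, lact a (unit b) = unit (a * b)
  ract_unit : ∀ a b : A, ract (unit a) b = unit (a * b)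
  unit_mul : ∀ {n : ℕ} (a : A) (x : H n), mul (Nat.zero_add n) (unit a) x = lact a x
  mul_unit : ∀ {n : ℕ} (x : H n) (a : A), mul (Nat.add_zero n) x (unit a) = ract x a

/-- The closed linear span of the products `x * y` with `x ∈ X` and `y ∈ Y`. -/
def closedProd {B : Type v} [NonUnitalCStarAlgebra B] (X Y : Set B) : Submodule ℂ B :=
  (Submodule.span ℂ (Set.image2 (fun x y => x * y) X Y)).topologicalClosure

namespace WeakPartialProductSystem

variable {A : Type u} [NonUnitalCStarAlgebra A] {H : ℕ → Type u}
  [∀ n, NormedAddCommGroup (H n)] [∀ n, NormedSpace ℂ (H n)] [∀ n, Correspondence A (H n)]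
  (P : WeakPartialProductSystem A H)

/-- A weak representation in the C*-algebra `B`. -/
structure IsWeakRepresentation {B : Type v} [NonUnitalCStarAlgebra B]
    (ω : ∀ n, H n →ₗ[ℂ] B) : Prop where
  map_mul : ∀ {n m p : ℕ} (h : n + m = p) (x : H n) (y : H m),
    ω n x * ω m y = ω p (P.mul h x y)
  star_map_mul : ∀ {n : ℕ} (x y : H n), star (ω n x) * ω n y = ω 0 (P.unit (ip x y))

/-- A representation in the C*-algebra `B`: a weak representation such that
`ω_n(H_n)^* · ω_m(H_m) ⊆ ω_{m-n}(H_{m-n}) · B` for `m > n > 0` and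
`ω_n(H_n)^* · ω_m(H_m) ⊆ ω_{n-m}(H_{n-m})^* · B` for `n > m > 0`, where the dot denotes closed
linear spans of products. -/
structure IsRepresentation {B : Type v} [NonUnitalCStarAlgebra B]
    (ω : ∀ n, H n →ₗ[ℂ] B) : Prop extends P.IsWeakRepresentation ω where
  star_mul_le_of_lt : ∀ {n m : ℕ}, 0 < n → n < m →
    closedProd (star '' Set.range (ω n)) (Set.range (ω m)) ≤
      closedProd (Set.range (ω (m - n))) Set.univ
  star_mul_le_of_gt : ∀ {n m : ℕ}, 0 < m → m < n →
    closedProd (star '' Set.range (ω n)) (Set.range (ω m)) ≤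
      closedProd (star '' Set.range (ω (n - m))) Set.univ

/-- The creation operators `S_{n,m}(x) : H m → H (n + m)`, `y ↦ x · y`, are adjointable for all
`n`, `m` and all `x` in `H n`; in other words, the Fock representation exists as a weak
representation by adjointable operators on the Hilbert module `⨁ H m`. -/
def CreationAdjointable : Prop :=
  ∀ (n m p : ℕ) (h : n + m = p) (x : H n),
    ∃ S : H p → H m, ∀ (t : H p) (y : H m), (ip t (P.mul h x y) : A) = ip (S t) y

/-- The annihilation operator `S_{n,m}(x)^* : H (n + m) → H m`, the adjoint of `y ↦ x · y`. -/
noncomputable def annihilation {P : WeakPartialProductSystem A H} (hP : P.CreationAdjointable)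
    {n m p : ℕ} (h : n + m = p) (x : H n) : H p → H m :=
  (hP n m p h x).choose

/-- A weak partial product system is a partial product system if the Fock representation
exists (the creation operators are adjointable) and is a representation, that is,
`S_n(x)^* S_m(y) = S_{m-n}(S_n(x)^* y)` for `m > n > 0`, `x ∈ H n`, `y ∈ H m`.  This is an identity
between operators on the Fock module `⨁ H l`; it is written out on `z ∈ H l`, with
`m = n + k`. -/
structure IsPartialProductSystem : Prop where
  adjointable : P.CreationAdjointable
  covariant : ∀ {n k m l p q : ℕ} (hm : n + k = m) (hp : m + l = p) (hq : k + l = q)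
    (hnq : n + q = p), 0 < n → 0 < k → ∀ (x : H n) (y : H m) (z : H l),
    annihilation adjointable hnq x (P.mul hp y z) =
      P.mul hq (annihilation adjointable hm x y) z

/-- The C*-algebra `T` with the representation `ω` is a Toeplitz algebra of `P`: for every
representation `σ` in a C*-algebra `B` there is a unique *-homomorphism `ρ : T → B` with
`ρ ∘ ω n = σ n` for all `n`. -/
structure IsToeplitzAlgebra {T : Type u} [NonUnitalCStarAlgebra T]
    (ω : ∀ n, H n →ₗ[ℂ] T) : Prop where
  isRepresentation : P.IsRepresentation ω
  existsUnique_hom : ∀ {B : Type u} [NonUnitalCStarAlgebra B] (σ : ∀ n, H n →ₗ[ℂ] B),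
    P.IsRepresentation σ → ∃! ρ : T →⋆ₙₐ[ℂ] B, ∀ n x, ρ (ω n x) = σ n x

end WeakPartialProductSystem

/-! ### Circle actions -/

/-- A continuous action of the circle group on a C*-algebra by *-automorphisms. -/
structure CircleAction (B : Type v) [NonUnitalCStarAlgebra B] where
  /-- The underlying group homomorphism to the group of *-automorphisms. -/
  toHom : Circle →* (B ≃⋆ₐ[ℂ] B)
  continuous_orbit : ∀ b : B, Continuous fun t => toHom t b

/-- The fixed-point algebra of a circle action. -/
def CircleAction.fixedPoints {B : Type v} [NonUnitalCStarAlgebra B] (α : CircleAction B) :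
    NonUnitalStarSubalgebra ℂ B where
  carrier := {b | ∀ t, α.toHom t b = b}
  add_mem' ha hb t := by rw [map_add, ha t, hb t]
  zero_mem' t := map_zero _
  mul_mem' ha hb t := by rw [map_mul, ha t, hb t]
  smul_mem' c a ha t := by rw [map_smul, ha t]
  star_mem' ha t := by rw [map_star, ha t]

/-! ### The gauge action on a Toeplitz algebra -/

namespace WeakPartialProductSystem

variable {A : Type u} [NonUnitalCStarAlgebra A] {H : ℕ → Type u}
  [∀ n, NormedAddCommGroup (H n)] [∀ n, NormedSpace ℂ (H n)] [∀ n, Correspondence A (H n)]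
  {P : WeakPartialProductSystem A H}

lemma mul_mem_closedProd {B : Type v} [NonUnitalCStarAlgebra B] {X Y : Set B} {x y : B}
    (hx : x ∈ X) (hy : y ∈ Y) : x * y ∈ closedProd X Y :=
  Submodule.le_topologicalClosure _ (Submodule.subset_span ⟨x, hx, y, hy, rfl⟩)

lemma closedProd_le_iff {B : Type v} [NonUnitalCStarAlgebra B] {X Y X' Y' : Set B} :
    closedProd X Y ≤ closedProd X' Y' ↔ ∀ x ∈ X, ∀ y ∈ Y, x * y ∈ closedProd X' Y' := by
  constructor
  · exact fun h x hx y hy => h (mul_mem_closedProd hx hy)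
  · intro h
    refine Submodule.topologicalClosure_minimal _ (Submodule.span_le.2 ?_)
      (Submodule.isClosed_topologicalClosure _)
    rintro _ ⟨x, hx, y, hy, rfl⟩
    exact h x hx y hy

/-- A continuous linear map sends a closed span of products into any closed span of products that
contains the images of the products. -/
lemma map_mem_closedProd {B C : Type*} [NonUnitalCStarAlgebra B] [NonUnitalCStarAlgebra C]
    (f : B →L[ℂ] C) {X Y : Set B} {X' Y' : Set C}
    (h : ∀ x ∈ X, ∀ y ∈ Y, f (x * y) ∈ closedProd X' Y') {b : B} (hb : b ∈ closedProd X Y) :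
    f b ∈ closedProd X' Y' := by
  have hle : closedProd X Y ≤ (closedProd X' Y').comap (f : B →ₗ[ℂ] C) := by
    refine Submodule.topologicalClosure_minimal _ (Submodule.span_le.2 ?_) ?_
    · rintro _ ⟨x, hx, y, hy, rfl⟩
      exact h x hx y hy
    · exact (Submodule.isClosed_topologicalClosure _).preimage f.continuous
  exact hle hb

/-- The image of a representation under a *-homomorphism is a representation. -/
lemma IsRepresentation.comp {B C : Type u} [NonUnitalCStarAlgebra B] [NonUnitalCStarAlgebra C]
    {ω : ∀ n, H n →ₗ[ℂ] B} (hω : P.IsRepresentation ω) (φ : B →⋆ₙₐ[ℂ] C) :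
    P.IsRepresentation fun n => (φ : B →ₗ[ℂ] C) ∘ₗ ω n where
  map_mul h x y := by simp [← map_mul, hω.map_mul h]
  star_map_mul x y := by simp [← map_mul, ← map_star, hω.star_map_mul]
  star_mul_le_of_lt {n m} hn hnm := by
    let f : B →L[ℂ] C := ⟨(φ : B →ₗ[ℂ] C), AddMonoidHomClass.continuous_of_bound φ 1
      fun b => by simpa using NonUnitalStarAlgHom.norm_apply_le φ b⟩
    rw [closedProd_le_iff]
    rintro _ ⟨_, ⟨x, rfl⟩, rfl⟩ _ ⟨y, rfl⟩
    have := map_mem_closedProd f (X := Set.range (ω (m - n))) (Y := Set.univ)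
      (X' := Set.range fun z => φ (ω (m - n) z)) (Y' := Set.univ)
      (by
        rintro _ ⟨z, rfl⟩ b -
        have : f (ω (m - n) z * b) = φ (ω (m - n) z) * φ b := map_mul φ _ _
        rw [this]
        exact mul_mem_closedProd ⟨z, rfl⟩ trivial)
      (closedProd_le_iff.1 (hω.star_mul_le_of_lt hn hnm) _ ⟨_, ⟨x, rfl⟩, rfl⟩ _ ⟨y, rfl⟩)
    have h2 : f (star (ω n x) * ω m y) = star (φ (ω n x)) * φ (ω m y) := by
      change φ _ = _
      rw [map_mul, map_star]
    rw [h2] at this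
    exact this
  star_mul_le_of_gt {n m} hm hnm := by
    let f : B →L[ℂ] C := ⟨(φ : B →ₗ[ℂ] C), AddMonoidHomClass.continuous_of_bound φ 1
      fun b => by simpa using NonUnitalStarAlgHom.norm_apply_le φ b⟩
    rw [closedProd_le_iff]
    rintro _ ⟨_, ⟨x, rfl⟩, rfl⟩ _ ⟨y, rfl⟩
    have := map_mem_closedProd f (X := star '' Set.range (ω (n - m))) (Y := Set.univ)
      (X' := star '' Set.range fun z => φ (ω (n - m) z)) (Y' := Set.univ)
      (by
        rintro _ ⟨_, ⟨z, rfl⟩, rfl⟩ b -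
        have : f (star (ω (n - m) z) * b) = star (φ (ω (n - m) z)) * φ b := by
          change φ _ = _
          rw [map_mul, map_star]
        rw [this]
        exact mul_mem_closedProd ⟨_, ⟨z, rfl⟩, rfl⟩ trivial)
      (closedProd_le_iff.1 (hω.star_mul_le_of_gt hm hnm) _ ⟨_, ⟨x, rfl⟩, rfl⟩ _ ⟨y, rfl⟩)
    have h2 : f (star (ω n x) * ω m y) = star (φ (ω n x)) * φ (ω m y) := by
      change φ _ = _
      rw [map_mul, map_star]
    rw [h2] at this
    exact this

/-- For `k : ℤ`, the continuous linear map from `T` to `C(Circle, T)` that sends `b` to the function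
`t ↦ t ^ k b`. -/
noncomputable def twist (T : Type u) [NonUnitalCStarAlgebra T] (k : ℤ) : T →L[ℂ] C(Circle, T) :=
  LinearMap.mkContinuous
    { toFun := fun b => ⟨fun t => ((t ^ k : Circle) : ℂ) • b,
        ((by fun_prop : Continuous fun z : Circle => (z : ℂ)).comp (continuous_zpow k)).smul continuous_const⟩
      map_add' := fun a b => by ext t; simp
      map_smul' := fun c b => by ext t; simp [smul_comm c] } 1
    (fun b => by
      rw [one_mul, ContinuousMap.norm_le _ (norm_nonneg b)]
      intro t
      change ‖((t ^ k : Circle) : ℂ) • b‖ ≤ ‖b‖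
      rw [norm_smul, Circle.norm_coe, one_mul])

@[simp] lemma twist_apply {T : Type u} [NonUnitalCStarAlgebra T] (k : ℤ) (b : T) (t : Circle) :
    twist T k b t = ((t ^ k : Circle) : ℂ) • b := rfl

lemma twist_mul {T : Type u} [NonUnitalCStarAlgebra T] (j k : ℤ) (a b : T) :
    twist T j a * twist T k b = twist T (j + k) (a * b) := by
  ext t
  simp [zpow_add, smul_mul_smul_comm]

lemma star_twist {T : Type u} [NonUnitalCStarAlgebra T] (k : ℤ) (a : T) :
    star (twist T k a) = twist T (-k) (star a) := by
  ext t
  simp [← Circle.coe_inv_eq_conj]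

/-- The maps `x ↦ (t ↦ t ^ n ω_n(x))` from `H n` to `C(Circle, T)`. -/
noncomputable def gaugeRep {T : Type u} [NonUnitalCStarAlgebra T] (ω : ∀ n, H n →ₗ[ℂ] T) (n : ℕ) :
    H n →ₗ[ℂ] C(Circle, T) :=
  (twist T n : T →ₗ[ℂ] C(Circle, T)) ∘ₗ ω n

lemma gaugeRep_apply {T : Type u} [NonUnitalCStarAlgebra T] (ω : ∀ n, H n →ₗ[ℂ] T) (n : ℕ)
    (x : H n) : gaugeRep ω n x = twist T n (ω n x) := rfl

lemma isRepresentation_gaugeRep {T : Type u} [NonUnitalCStarAlgebra T] {ω : ∀ n, H n →ₗ[ℂ] T}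
    (hω : P.IsRepresentation ω) : P.IsRepresentation (gaugeRep ω) where
  map_mul {n m p} h x y := by
    simp only [gaugeRep_apply, twist_mul, hω.map_mul h]
    subst h
    simp
  star_map_mul x y := by
    simp only [gaugeRep_apply, star_twist, twist_mul, hω.star_map_mul]
    simp
  star_mul_le_of_lt {n m} hn hnm := by
    rw [closedProd_le_iff]
    rintro _ ⟨_, ⟨x, rfl⟩, rfl⟩ _ ⟨y, rfl⟩
    rw [gaugeRep_apply, gaugeRep_apply, star_twist, twist_mul]
    refine map_mem_closedProd _ (X := Set.range (ω (m - n))) (Y := Set.univ) ?_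
      (closedProd_le_iff.1 (hω.star_mul_le_of_lt hn hnm) _ ⟨_, ⟨x, rfl⟩, rfl⟩ _ ⟨y, rfl⟩)
    rintro _ ⟨z, rfl⟩ b -
    have h1 : twist T (-(n : ℤ) + m) (ω (m - n) z * b) = gaugeRep ω (m - n) z * twist T 0 b := by
      rw [gaugeRep_apply, twist_mul]
      congr 2
      omega
    rw [h1]
    exact mul_mem_closedProd ⟨z, rfl⟩ trivial
  star_mul_le_of_gt {n m} hm hnm := by
    rw [closedProd_le_iff]
    rintro _ ⟨_, ⟨x, rfl⟩, rfl⟩ _ ⟨y, rfl⟩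
    rw [gaugeRep_apply, gaugeRep_apply, star_twist, twist_mul]
    refine map_mem_closedProd _ (X := star '' Set.range (ω (n - m))) (Y := Set.univ) ?_
      (closedProd_le_iff.1 (hω.star_mul_le_of_gt hm hnm) _ ⟨_, ⟨x, rfl⟩, rfl⟩ _ ⟨y, rfl⟩)
    rintro _ ⟨_, ⟨z, rfl⟩, rfl⟩ b -
    have h1 : twist T (-(n : ℤ) + m) (star (ω (n - m) z) * b) =
        star (gaugeRep ω (n - m) z) * twist T 0 b := by
      rw [gaugeRep_apply, star_twist, twist_mul]
      congr 2
      omega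
    rw [h1]
    exact mul_mem_closedProd ⟨_, ⟨z, rfl⟩, rfl⟩ trivial

namespace IsToeplitzAlgebra

variable {T : Type u} [NonUnitalCStarAlgebra T] {ω : ∀ n, H n →ₗ[ℂ] T}

/-- Two *-homomorphisms from a Toeplitz algebra that agree on the generators are equal. -/
lemma hom_ext (hT : P.IsToeplitzAlgebra ω) {B : Type u} [NonUnitalCStarAlgebra B]
    {f g : T →⋆ₙₐ[ℂ] B} (h : ∀ n x, f (ω n x) = g (ω n x)) : f = g :=
  (hT.existsUnique_hom _ (hT.isRepresentation.comp g)).unique h fun _ _ => rfl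

/-- The *-homomorphism `T → C(Circle, T)` with `ω_n(x) ↦ (t ↦ t ^ n ω_n(x))`, given by the
universal property. -/
noncomputable def gaugeHom (hT : P.IsToeplitzAlgebra ω) : T →⋆ₙₐ[ℂ] C(Circle, T) :=
  (hT.existsUnique_hom _ (isRepresentation_gaugeRep hT.isRepresentation)).choose

lemma gaugeHom_apply (hT : P.IsToeplitzAlgebra ω) (n : ℕ) (x : H n) (t : Circle) :
    hT.gaugeHom (ω n x) t = ((t ^ n : Circle) : ℂ) • ω n x := by
  have := (hT.existsUnique_hom _ (isRepresentation_gaugeRep hT.isRepresentation)).choose_spec.1 n x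
  rw [gaugeHom, this, gaugeRep_apply, twist_apply, zpow_natCast]

/-- The *-endomorphism `α_t = ev_t ∘ α` of `T`. -/
noncomputable def gaugeEnd (hT : P.IsToeplitzAlgebra ω) (t : Circle) : T →⋆ₙₐ[ℂ] T where
  toFun b := hT.gaugeHom b t
  map_smul' c b := by simp
  map_zero' := by simp
  map_add' a b := by simp
  map_mul' a b := by simp
  map_star' a := by simp [map_star]

lemma gaugeEnd_apply (hT : P.IsToeplitzAlgebra ω) (t : Circle) (n : ℕ) (x : H n) :
    hT.gaugeEnd t (ω n x) = ((t ^ n : Circle) : ℂ) • ω n x :=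
  hT.gaugeHom_apply n x t

lemma gaugeEnd_one (hT : P.IsToeplitzAlgebra ω) (b : T) : hT.gaugeEnd 1 b = b := by
  have : hT.gaugeEnd 1 = NonUnitalStarAlgHom.id ℂ T :=
    hT.hom_ext fun n x => by simp [gaugeEnd_apply]
  rw [this]
  rfl

lemma gaugeEnd_mul (hT : P.IsToeplitzAlgebra ω) (s t : Circle) (b : T) :
    hT.gaugeEnd (s * t) b = hT.gaugeEnd s (hT.gaugeEnd t b) := by
  have : hT.gaugeEnd (s * t) = (hT.gaugeEnd s).comp (hT.gaugeEnd t) :=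
    hT.hom_ext fun n x => by
      simp [gaugeEnd_apply, mul_pow, smul_smul, mul_comm]
  rw [this]
  rfl

/-- The gauge action on a Toeplitz algebra, the continuous circle action with
`α_t(ω_n(x)) = t ^ n ω_n(x)`. -/
noncomputable def gaugeAction (hT : P.IsToeplitzAlgebra ω) : CircleAction T where
  toHom :=
    { toFun := fun t =>
        { hT.gaugeEnd t with
          invFun := hT.gaugeEnd t⁻¹
          left_inv := fun b => by
            change hT.gaugeEnd t⁻¹ (hT.gaugeEnd t b) = b
            rw [← gaugeEnd_mul, inv_mul_cancel, gaugeEnd_one]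
          right_inv := fun b => by
            change hT.gaugeEnd t (hT.gaugeEnd t⁻¹ b) = b
            rw [← gaugeEnd_mul, mul_inv_cancel, gaugeEnd_one] }
      map_one' := by
        ext b
        exact hT.gaugeEnd_one b
      map_mul' := fun s t => by
        ext b
        exact hT.gaugeEnd_mul s t b }
  continuous_orbit b := (hT.gaugeHom b).continuous

/-- The gauge action multiplies `ω_n(x)` by `t ^ n`. -/
lemma gaugeAction_apply (hT : P.IsToeplitzAlgebra ω) (t : Circle) (n : ℕ) (x : H n) :
    hT.gaugeAction.toHom t (ω n x) = (t : ℂ) ^ n • ω n x := by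
  rw [← Circle.coe_pow]
  exact hT.gaugeEnd_apply t n x

end IsToeplitzAlgebra

end WeakPartialProductSystem

/-! The argument is averaging over the circle. For an action `α` put `E(y) = ∫ α_t(y) dt`.
Invariance of Haar measure places `E(y)` in the fixed-point algebra. If `ρ x = 0`, equivariance
gives `ρ(α_t(x* x)) = β_t(ρ(x)* ρ(x)) = 0` for every `t`, hence `ρ(E(x* x)) = 0`, and injectivity on
fixed points forces `E(x* x) = 0`. It remains to see that `E` is faithful, which is
`eq_zero_of_integral_star_mul_self_eq_zero` applied to the orbit map `t ↦ α_t(x)`. Nothing here is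
special to Toeplitz algebras: the universal property serves only to produce the gauge action. -/

open MeasureTheory in
/-- A continuous nonnegative function with values in a C*-algebra and with integral zero with respect
to a measure that is positive on nonempty open sets vanishes identically. -/
lemma eq_zero_of_integral_star_mul_self_eq_zero {X : Type*} [TopologicalSpace X] [CompactSpace X]
    [MeasurableSpace X] [BorelSpace X] {μ : Measure X} [IsFiniteMeasureOnCompacts μ]
    [μ.IsOpenPosMeasure] {B : Type*} [NonUnitalCStarAlgebra B] {f : X → B} (hf : Continuous f)
    (h : ∫ x, star (f x) * f x ∂μ = 0) : f = 0 := by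
  -- In the spectral order every `star b * b` is nonnegative, so integrals of such elements can be
  -- compared.
  let _ := CStarAlgebra.spectralOrder B
  let _ := CStarAlgebra.spectralOrderedRing B
  have hc : Continuous fun x => star (f x) * f x := by fun_prop
  have hi : Integrable (fun x => star (f x) * f x) μ :=
    hc.integrable_of_hasCompactSupport (HasCompactSupport.of_compactSpace _)
  have h0 : (0 : X → B) ≤ fun x => star (f x) * f x := fun x => star_mul_self_nonneg (f x)
  have hae : (fun x => star (f x) * f x) =ᵐ[μ] 0 := by
    -- Positivity squeezes the integral over each measurable set between `0` and the full integral,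
    -- which is `0`.
    refine hi.ae_eq_zero_of_forall_setIntegral_eq_zero fun s _ _ => le_antisymm ?_ ?_
    · rw [← h]
      exact integral_mono_measure Measure.restrict_le_self (Filter.Eventually.of_forall h0) hi
    · exact integral_nonneg h0
  funext x
  -- Continuous functions that agree almost everywhere agree everywhere, since `μ` charges every
  -- nonempty open set.
  exact CStarRing.star_mul_self_eq_zero_iff (f x) |>.1
    (congrFun ((hc.ae_eq_iff_eq μ continuous_zero).1 hae) x)

open MeasureTheory in
/-- An equivariant *-homomorphism between C*-algebras with circle actions is injective if it is
injective on the fixed-point algebra: the conditional expectation onto the fixed-point algebra,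
given by averaging over the circle, is faithful. -/
theorem CircleAction.injective_of_injOn_fixedPoints {T : Type u} {B : Type v}
    [NonUnitalCStarAlgebra T] [NonUnitalCStarAlgebra B] (α : CircleAction T) (β : CircleAction B)
    (ρ : T →⋆ₙₐ[ℂ] B) (hρ : ∀ (t : Circle) (x : T), ρ (α.toHom t x) = β.toHom t (ρ x))
    (hinj : Set.InjOn ρ α.fixedPoints) : Function.Injective ρ := by
  let _ : MeasurableSpace Circle := borel Circle
  have _ : BorelSpace Circle := ⟨rfl⟩
  -- The normalisation is irrelevant: only invariance, finiteness on compact sets and positivity on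
  -- nonempty open sets matter.
  let μ : Measure Circle := Measure.haar
  rw [injective_iff_map_eq_zero]
  intro x hx
  have hint (y : T) : Integrable (fun t => α.toHom t y) μ :=
    (α.continuous_orbit y).integrable_of_hasCompactSupport (HasCompactSupport.of_compactSpace _)
  have hfix : (∫ t, α.toHom t (star x * x) ∂μ) ∈ α.fixedPoints := by
    intro s
    -- As a continuous linear map, `α_s` can be moved inside the integral.
    let L : T →L[ℂ] T := ⟨(α.toHom s : T →ₗ[ℂ] T), (NonUnitalStarAlgHom.isometry
      (α.toHom s : T →⋆ₙₐ[ℂ] T) (α.toHom s).injective).continuous⟩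
    have h1 := L.integral_comp_comm (hint (star x * x))
    have h2 (t : Circle) : L (α.toHom t (star x * x)) = α.toHom (s * t) (star x * x) := by
      rw [map_mul α.toHom]; rfl
    simp only [h2] at h1
    -- Translating the variable by `s` leaves the Haar integral unchanged.
    exact h1.symm.trans (integral_mul_left_eq_self (fun t => α.toHom t (star x * x)) s)
  have hzero : ρ (∫ t, α.toHom t (star x * x) ∂μ) = 0 := by
    let L : T →L[ℂ] B := ⟨(ρ : T →ₗ[ℂ] B), AddMonoidHomClass.continuous_of_bound ρ 1
      fun b => by simpa using NonUnitalStarAlgHom.norm_apply_le ρ b⟩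
    have h1 := L.integral_comp_comm (hint (star x * x))
    have h2 (t : Circle) : L (α.toHom t (star x * x)) = 0 :=
      -- Equivariance makes the kernel of `ρ` invariant under `α`, so the whole orbit of `x* x` is
      -- killed.
      (hρ t _).trans (by simp [hx])
    simp only [h2, integral_zero] at h1
    exact h1.symm
  have hE : ∫ t, α.toHom t (star x * x) ∂μ = 0 :=
    hinj hfix (zero_mem _) (hzero.trans (map_zero ρ).symm)
  -- The integrand becomes `star (α_t x) * α_t x`, so faithfulness yields `α_t x = 0` for all `t`;
  -- evaluating at `t = 1` gives `x = 0`.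
  simp only [map_mul, map_star] at hE
  simpa using congrFun (eq_zero_of_integral_star_mul_self_eq_zero (α.continuous_orbit x) hE) 1

theorem mainTheorem7 {A : Type u} [NonUnitalCStarAlgebra A] {H : ℕ → Type u}
    [∀ n, NormedAddCommGroup (H n)] [∀ n, NormedSpace ℂ (H n)] [∀ n, Correspondence A (H n)]
    (P : WeakPartialProductSystem A H) (hP : P.IsPartialProductSystem)
    {T : Type u} [NonUnitalCStarAlgebra T] (ω : ∀ n, H n →ₗ[ℂ] T) (hT : P.IsToeplitzAlgebra ω)
    {B : Type v} [NonUnitalCStarAlgebra B] (β : CircleAction B) (ρ : T →⋆ₙₐ[ℂ] B)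
    (hρ : ∀ (t : Circle) (x : T), ρ (hT.gaugeAction.toHom t x) = β.toHom t (ρ x))
    (hinj : Set.InjOn ρ hT.gaugeAction.fixedPoints) :
    Function.Injective ρ :=
  hT.gaugeAction.injective_of_injOn_fixedPoints β ρ hρ hinj
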